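/- For a subset $\mathcal M$ of a normed space and $\varepsilon>0$, let $\mathcal N(\mathcal M,\|\cdot\|,\varepsilon)$ denote its $\varepsilon$-covering number: the smallest cardinality of a set $\mathcal Q\subset\mathcal M$ such that every $z\in\mathcal M$ satisfies $\|x-z\|\le\varepsilon$ for some $x\in\mathcal Q$. Let $0\le n\le m$ be integers, let $\mathcal H$ be a complex Hilbert space of finite dimension $m$, let $G_{n,m}$ be the set of all orthogonal projection operators of rank $n$ on $\mathcal H$, let $\|\cdot\|$ be the operator norm, and put $\mathcal N_G(\varepsilon)=\mathcal N(G_{n,m},\|\cdot\|,\varepsilon)$. Then $$\frac{1}{19^{m^2}}\left(\frac{9}{5\varepsilon}\right)^{2n(m-n)}\le \mathcal N_G(\varepsilon)\quad\text{for } 0<\varepsilon\le \tfrac1{71},$$ $$\mathcal N_G(\varepsilon)\le 38^{m^2}\left(\frac{3}{4\varepsilon}\right)^{2n(m-n)}\quad\text{for } 0<\varepsilon\le\tfrac1{10}.$$ In particular, when $n$ and $m-n$ are at least fixed fractions of $m$ and $\varepsilon$ is sufficiently small, $\mathcal N_G(\varepsilon)=\exp[\Omega(m^2)]$. That is, for every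 $\alpha>0$ there are $\varepsilon_0>0$ and $c>0$, depending only on $\alpha$, such that $\mathcal N_G(\varepsilon)\ge e^{c m^2}$ for all $0<\varepsilon\le\varepsilon_0$ and all $m,n$ with $n\ge\alpha m$ and $m-n\ge\alpha m$. -/

import Mathlib

/-- The Grassmannian of a complex Hilbert space `H`, realised as the set of all (orthogonal)
projection operators of rank `n`, inside the bounded operators with the operator norm. -/
def rankProjections (H : Type*) [NormedAddCommGroup H] [InnerProductSpace ℂ H] [CompleteSpace H]
    (n : ℕ) : Set (H →L[ℂ] H) :=
  {P | IsStarProjection P ∧ Module.finrank ℂ (LinearMap.range (P : H →ₗ[ℂ] H)) = n}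

open scoped NNReal ENNReal

/-! Both bounds compare the Grassmannian with a ball in `E →L[ℂ] Eᗮ`, `dim E = n`, of real dimension
`2n(m-n)`, where volumes count. Above: all projections lie in a ball of radius 1/2 in an
`m²`-dimensional space, so `25^(m²)` balls of radius 1/4 cover them. Within each, the corner of a
projection determines it up to a factor 2 (`norm_sub_le_norm_corner`), leaving at most
`(1+1/ε)^(2n(m-n))` separated points. Below: `X` is recovered from the projection onto its graph in
a 4-Lipschitz way on the unit ball (`norm_sub_le_graphProjection`), so an ε-cover yields an 8ε-cover
of that ball. The stated constants then follow from `2n(m-n) ≤ m²`. -/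

open Metric MeasureTheory Module

/-! ### Volume comparison in finite dimension -/

section Volume

variable {V : Type*} [NormedAddCommGroup V] [NormedSpace ℂ V] [FiniteDimensional ℂ V]

/-- Volume bound for a `t`-separated subset of a ball of radius `R`. -/
theorem card_le_of_separated_of_norm_sub_le (s : Finset V) (a : V) {R t : ℝ} (hR : 0 ≤ R)
    (ht : 0 < t) (hs : ∀ c ∈ s, ‖c - a‖ ≤ R)
    (h : ∀ c ∈ s, ∀ d ∈ s, c ≠ d → t ≤ ‖c - d‖) :
    (s.card : ℝ) ≤ (1 + 2 * R / t) ^ (2 * finrank ℂ V) := by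
  borelize V
  let _ : NormedSpace ℝ V := NormedSpace.complexToReal
  have : FiniteDimensional ℝ V := FiniteDimensional.complexToReal V
  let μ : Measure V := Measure.addHaar
  have hd : finrank ℝ V = 2 * finrank ℂ V := finrank_real_of_complex V
  have hρ : 0 < R + t / 2 := by positivity
  have D : Set.Pairwise (s : Set V) (Function.onFun Disjoint fun c => ball (c : V) (t / 2)) := by
    rintro c hc d hd hcd
    apply ball_disjoint_ball
    rw [dist_eq_norm]
    linarith [h c hc d hd hcd]
  -- The disjoint balls of radius `t / 2` fit in a ball of radius `R + t / 2`; the ratio of radii is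
  -- `1 + 2R/t`.
  have A_subset : (⋃ c ∈ s, ball (c : V) (t / 2)) ⊆ ball a (R + t / 2) := by
    refine Set.iUnion₂_subset fun x hx => ball_subset_ball' ?_
    rw [dist_eq_norm]
    linarith [hs x hx]
  have I : (s.card : ℝ≥0∞) * ENNReal.ofReal ((t / 2) ^ finrank ℝ V) * μ (ball 0 1) ≤
      ENNReal.ofReal ((R + t / 2) ^ finrank ℝ V) * μ (ball 0 1) := by
    have := measure_mono (μ := μ) A_subset
    rw [measure_biUnion_finset D fun c _ => measurableSet_ball] at this
    simpa only [μ.addHaar_ball_of_pos _ hρ, μ.addHaar_ball_of_pos _ (half_pos ht),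
      Finset.sum_const, nsmul_eq_mul, mul_assoc] using this
  have J := (ENNReal.mul_le_mul_iff_left (measure_ball_pos _ _ zero_lt_one).ne'
    measure_ball_lt_top.ne).1 I
  have K := ENNReal.toReal_le_of_le_ofReal (by positivity) J
  rw [ENNReal.toReal_mul, ENNReal.toReal_natCast, ENNReal.toReal_ofReal (by positivity), hd] at K
  have e : R + t / 2 = (1 + 2 * R / t) * (t / 2) := by field_simp; ring
  rw [e, mul_pow] at K
  exact le_of_mul_le_mul_right K (by positivity)

/-- Volume bound for a cover of the unit ball by closed balls of radius `r`. -/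
theorem one_le_card_mul_pow_of_cover (s : Finset V) {r : ℝ} (hr : 0 ≤ r)
    (h : ∀ x : V, ‖x‖ ≤ 1 → ∃ c ∈ s, ‖x - c‖ ≤ r) :
    1 ≤ (s.card : ℝ) * r ^ (2 * finrank ℂ V) := by
  borelize V
  let _ : NormedSpace ℝ V := NormedSpace.complexToReal
  have : FiniteDimensional ℝ V := FiniteDimensional.complexToReal V
  let μ : Measure V := Measure.addHaar
  have hd : finrank ℝ V = 2 * finrank ℂ V := finrank_real_of_complex V
  have A_subset : ball (0 : V) 1 ⊆ ⋃ c ∈ s, closedBall (c : V) r := by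
    intro x hx
    obtain ⟨c, hc, hxc⟩ := h x (mem_ball_zero_iff.1 hx).le
    simp only [Set.mem_iUnion]
    exact ⟨c, hc, by simpa [dist_eq_norm] using hxc⟩
  have I : 1 * μ (ball 0 1) ≤
      (s.card : ℝ≥0∞) * ENNReal.ofReal (r ^ finrank ℝ V) * μ (ball 0 1) := by
    have := (measure_mono (μ := μ) A_subset).trans (measure_biUnion_finset_le s _)
    simpa only [μ.addHaar_closedBall _ hr, Finset.sum_const, nsmul_eq_mul, mul_assoc, one_mul]
      using this
  have J := (ENNReal.mul_le_mul_iff_left (measure_ball_pos _ _ zero_lt_one).ne'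
    measure_ball_lt_top.ne).1 I
  rw [← ENNReal.ofReal_natCast, ← ENNReal.ofReal_mul (by positivity), ENNReal.one_le_ofReal,
    hd] at J
  exact J

end Volume

/-! ### Packings and covers in terms of norms -/

/-- A bound on all finite separated subsets bounds the packing number. -/
theorem packingNumber_le_ofReal {X : Type*} [PseudoEMetricSpace X] {A : Set X} {ε : ℝ≥0} {K : ℝ}
    (h : ∀ s : Finset X, (s : Set X) ⊆ A → IsSeparated ε (s : Set X) → (s.card : ℝ) ≤ K) :
    (packingNumber ε A : ℝ≥0∞) ≤ ENNReal.ofReal K := by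
  have hK : 0 ≤ K := by simpa using h ∅ (by simp) (by simp)
  have key : packingNumber ε A ≤ (⌊K⌋₊ : ℕ∞) := by
    refine iSup_le fun C => iSup_le fun hCA => iSup_le fun hC => ?_
    by_contra! hlt
    -- The separated set may be infinite; a finite piece with `⌊K⌋₊ + 1` points already contradicts
    -- the bound.
    obtain ⟨t, htC, ht⟩ := Set.exists_subset_encard_eq (Order.add_one_le_of_lt hlt)
    have hfin : t.Finite := Set.finite_of_encard_eq_coe (k := ⌊K⌋₊ + 1) (by simpa using ht)
    lift t to Finset X using hfin
    rw [Set.encard_coe_eq_coe_finsetCard] at ht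
    have hc : t.card = ⌊K⌋₊ + 1 := by exact_mod_cast ht
    have := h t (htC.trans hCA) (hC.mono htC)
    rw [hc] at this
    push_cast at this
    linarith [Nat.lt_floor_add_one K]
  calc (packingNumber ε A : ℝ≥0∞) ≤ ((⌊K⌋₊ : ℕ∞) : ℝ≥0∞) := by exact_mod_cast key
    _ = ENNReal.ofReal (⌊K⌋₊ : ℝ) := by simp
    _ ≤ ENNReal.ofReal K := ENNReal.ofReal_le_ofReal (Nat.floor_le hK)

theorem le_norm_sub_of_isSeparated {V : Type*} [NormedAddCommGroup V] {ε : ℝ≥0} {s : Set V}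
    (h : IsSeparated ε s) {c d : V} (hc : c ∈ s) (hd : d ∈ s) (hcd : c ≠ d) :
    (ε : ℝ) ≤ ‖c - d‖ := by
  have : (ε : ℝ≥0∞) < edist c d := h hc hd hcd
  rw [edist_nndist] at this
  rw [← dist_eq_norm, ← coe_nndist]
  exact_mod_cast this.le

theorem exists_norm_sub_le_of_isCover {V : Type*} [NormedAddCommGroup V] {ε : ℝ≥0} {s t : Set V}
    (h : IsCover ε s t) {c : V} (hc : c ∈ s) : ∃ d ∈ t, ‖c - d‖ ≤ ε := by
  obtain ⟨d, hd, hcd⟩ := h hc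
  refine ⟨d, hd, ?_⟩
  rw [← dist_eq_norm, ← coe_nndist]
  simp only [edist_nndist] at hcd
  exact_mod_cast hcd

/-! ### Orthogonal splittings, graphs and corners -/

section Grassmannian

variable {H : Type*} [NormedAddCommGroup H] [InnerProductSpace ℂ H]

/-- Pythagoras: two blocks bounded by `c`, acting on orthogonal components of a vector and with
orthogonal images, add up without loss in the constant. -/
theorem norm_add_le_of_mem_orthogonal {E : Submodule ℂ H} {a b : H} (ha : a ∈ E) (hb : b ∈ Eᗮ)
    {c s t r : ℝ} (hr : 0 ≤ r) (hc : 0 ≤ c) (hA : ‖a‖ ≤ c * s) (hB : ‖b‖ ≤ c * t)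
    (hst : s ^ 2 + t ^ 2 = r ^ 2) : ‖a + b‖ ≤ c * r := by
  have h := norm_add_sq_eq_norm_sq_add_norm_sq_of_inner_eq_zero a b
    (E.inner_right_of_mem_orthogonal ha hb)
  refine le_of_sq_le_sq ?_ (by positivity)
  have h1 := pow_le_pow_left₀ (norm_nonneg a) hA 2
  have h2 := pow_le_pow_left₀ (norm_nonneg b) hB 2
  have h3 : (c * r) ^ 2 = (c * s) ^ 2 + (c * t) ^ 2 := by rw [mul_pow, ← hst]; ring
  nlinarith

theorem norm_le_norm_add_of_mem_orthogonal {E : Submodule ℂ H} {a b : H} (ha : a ∈ E)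
    (hb : b ∈ Eᗮ) : ‖a‖ ≤ ‖a + b‖ ∧ ‖b‖ ≤ ‖a + b‖ := by
  have h := norm_add_sq_eq_norm_sq_add_norm_sq_of_inner_eq_zero a b
    (E.inner_right_of_mem_orthogonal ha hb)
  constructor <;> refine le_of_sq_le_sq ?_ (norm_nonneg _) <;>
    nlinarith [norm_nonneg a, norm_nonneg b]

/-- The parametrisation of the graph of `X : E → Eᗮ`. -/
noncomputable def graphMap {E : Submodule ℂ H} (X : E →L[ℂ] Eᗮ) : E →ₗ[ℂ] H :=
  E.subtype + Eᗮ.subtype ∘ₗ (X : E →ₗ[ℂ] Eᗮ)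

theorem graphMap_apply {E : Submodule ℂ H} (X : E →L[ℂ] Eᗮ) (v : E) :
    graphMap X v = (v : H) + (X v : H) := rfl

/-- Orthogonal projections lie in the ball of radius `1 / 2` around half the identity. -/
theorem norm_sub_half_le [CompleteSpace H] {P : H →L[ℂ] H} (hP : IsStarProjection P) :
    ‖P - (1 / 2 : ℂ) • (1 : H →L[ℂ] H)‖ ≤ 1 / 2 := by
  obtain ⟨_, hP'⟩ := isStarProjection_iff_eq_starProjection_range.1 hP
  set E := P.range
  refine ContinuousLinearMap.opNorm_le_bound _ (by norm_num) fun x => ?_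
  -- `P - 1/2` is half the reflection `P - (1 - P)`.
  have hx : (P - (1 / 2 : ℂ) • (1 : H →L[ℂ] H)) x =
      (1 / 2 : ℂ) • P x + (-(1 / 2 : ℂ)) • Eᗮ.starProjection x := by
    have h := E.starProjection_add_starProjection_orthogonal x
    rw [← hP'] at h
    simp only [sub_apply, smul_apply, one_apply_eq_self]
    rw [← eq_sub_iff_add_eq'] at h
    rw [h]
    module
  rw [hx]
  have h1 := Submodule.norm_sq_eq_add_norm_sq_starProjection x E
  rw [← hP'] at h1
  refine norm_add_le_of_mem_orthogonal (E := E) (s := ‖P x‖) (t := ‖Eᗮ.starProjection x‖)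
    (E.smul_mem _ (by rw [hP']; exact E.starProjection_apply_mem x))
    (Eᗮ.smul_mem _ (Eᗮ.starProjection_apply_mem x)) (norm_nonneg x) (by norm_num) ?_ ?_ h1.symm
  · simp [norm_smul]
  · simp [norm_smul]

variable [FiniteDimensional ℂ H]

/-- The corner `E → Eᗮ` of an operator. -/
noncomputable def corner (E : Submodule ℂ H) : (H →L[ℂ] H) →ₗ[ℂ] (E →L[ℂ] Eᗮ) where
  toFun T := Eᗮ.orthogonalProjectionOnto ∘L T ∘L E.subtypeL
  map_add' S T := by ext; simp
  map_smul' c T := by ext; simp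

theorem norm_starProjection_orthogonal_le_corner (E : Submodule ℂ H) (T : H →L[ℂ] H) (x : H) :
    ‖Eᗮ.starProjection (T (E.starProjection x))‖ ≤ ‖corner E T‖ * ‖E.starProjection x‖ := by
  exact (corner E T).le_opNorm (E.orthogonalProjectionOnto x)

theorem norm_corner_le (E : Submodule ℂ H) (T : H →L[ℂ] H) : ‖corner E T‖ ≤ ‖T‖ := by
  refine ContinuousLinearMap.opNorm_le_bound _ (norm_nonneg _) fun x => ?_
  exact (Eᗮ.norm_starProjection_apply_le (T x)).trans (T.le_opNorm x)

theorem finrank_continuousLinearMap_orthogonal (E : Submodule ℂ H) :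
    finrank ℂ (E →L[ℂ] Eᗮ) = finrank ℂ E * (finrank ℂ H - finrank ℂ E) := by
  rw [← (LinearMap.toContinuousLinearMap (𝕜 := ℂ) (E := E) (F' := Eᗮ)).finrank_eq,
    Module.finrank_linearMap, ← E.finrank_add_finrank_orthogonal, Nat.add_sub_cancel_left]

theorem finrank_continuousLinearMap_self :
    finrank ℂ (H →L[ℂ] H) = finrank ℂ H ^ 2 := by
  rw [← (LinearMap.toContinuousLinearMap (𝕜 := ℂ) (E := H) (F' := H)).finrank_eq,
    Module.finrank_linearMap, sq]

/-- The orthogonal projection onto the graph of `X : E → Eᗮ`. -/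
noncomputable def graphProjection {E : Submodule ℂ H} (X : E →L[ℂ] Eᗮ) : H →L[ℂ] H :=
  (LinearMap.range (graphMap X)).starProjection

/-- Project `v + Xv` to `u + X'u` on the other graph. The error is at most `2N‖v‖`, hence so are its
components `v - u` and `Xv - X'u`; and `(X - X')v = (Xv - X'u) - X'(v - u)`. -/
theorem norm_sub_le_graphProjection {E : Submodule ℂ H} {X X' : E →L[ℂ] Eᗮ} (hX : ‖X‖ ≤ 1)
    (hX' : ‖X'‖ ≤ 1) : ‖X - X'‖ ≤ 4 * ‖graphProjection X - graphProjection X'‖ := by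
  refine ContinuousLinearMap.opNorm_le_bound _ (by positivity) fun v => ?_
  set N := ‖graphProjection X - graphProjection X'‖
  obtain ⟨u, hu⟩ : graphProjection X' (graphMap X v) ∈ LinearMap.range (graphMap X') :=
    Submodule.starProjection_apply_mem _ _
  have hz : graphProjection X (graphMap X v) = graphMap X v :=
    Submodule.starProjection_eq_self_iff.2 ⟨v, rfl⟩
  have h1 : ‖graphMap X v‖ ≤ 2 * ‖v‖ := by
    rw [graphMap_apply]
    refine (norm_add_le _ _).trans ?_
    have := X.le_of_opNorm_le hX v
    rw [← Submodule.coe_norm, ← Submodule.coe_norm]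
    linarith
  have h2 : ‖graphMap X v - graphMap X' u‖ ≤ N * (2 * ‖v‖) := by
    rw [hu]
    nth_rewrite 1 [← hz]
    exact ((graphProjection X - graphProjection X').le_opNorm _).trans
      (mul_le_mul_of_nonneg_left h1 (norm_nonneg _))
  have e : graphMap X v - graphMap X' u = ((v - u : E) : H) + ((X v - X' u : Eᗮ) : H) := by
    simp only [graphMap_apply, Submodule.coe_sub]; abel
  rw [e] at h2
  obtain ⟨h3, h4⟩ := norm_le_norm_add_of_mem_orthogonal (v - u).2 (X v - X' u).2
  have h5 : (X - X') v = (X v - X' u) - X' (v - u) := by simp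
  have h6 := X'.le_of_opNorm_le hX' (v - u)
  rw [h5]
  refine (norm_sub_le _ _).trans ?_
  rw [← Submodule.coe_norm] at h3 h4
  linarith

/-! ### The corner as a local chart, and the upper bound -/

variable [CompleteSpace H]

/-- A self-adjoint operator is controlled by its diagonal blocks and one off-diagonal block. -/
theorem norm_le_add_norm_corner (E : Submodule ℂ H) {D : H →L[ℂ] H} (hD : IsSelfAdjoint D) {c : ℝ}
    (hc : 0 ≤ c)
    (h1 : ∀ x, ‖E.starProjection (D (E.starProjection x))‖ ≤ c * ‖E.starProjection x‖)
    (h2 : ∀ x, ‖Eᗮ.starProjection (D (Eᗮ.starProjection x))‖ ≤ c * ‖Eᗮ.starProjection x‖) :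
    ‖D‖ ≤ c + ‖corner E D‖ := by
  -- The other off-diagonal block is the adjoint of the corner; pairing `y` with itself transfers
  -- the bound.
  have h3 (x : H) : ‖E.starProjection (D (Eᗮ.starProjection x))‖ ≤
      ‖corner E D‖ * ‖Eᗮ.starProjection x‖ := by
    set y := E.starProjection (D (Eᗮ.starProjection x)) with hy
    have hyE : E.starProjection y = y :=
      E.starProjection_eq_self_iff.2 (E.starProjection_apply_mem _)
    have h4 : ‖y‖ * ‖y‖ ≤ (‖corner E D‖ * ‖Eᗮ.starProjection x‖) * ‖y‖ := by
      have e : inner ℂ y y = inner ℂ (Eᗮ.starProjection (D (E.starProjection y)))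
          (Eᗮ.starProjection x) := by
        nth_rewrite 2 [hy]
        rw [← E.inner_starProjection_left_eq_right, Eᗮ.inner_starProjection_left_eq_right,
          Submodule.starProjection_eq_self_iff.2 (Eᗮ.starProjection_apply_mem x)]
        exact (ContinuousLinearMap.isSelfAdjoint_iff_isSymmetric.1 hD _ _).symm
      have := norm_inner_le_norm (𝕜 := ℂ) (Eᗮ.starProjection (D (E.starProjection y)))
        (Eᗮ.starProjection x)
      rw [← e, inner_self_eq_norm_sq_to_K, norm_pow, RCLike.norm_ofReal, abs_norm, sq] at this
      have h5 := norm_starProjection_orthogonal_le_corner E D y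
      rw [hyE] at this h5
      nlinarith [norm_nonneg (Eᗮ.starProjection x)]
    rcases (norm_nonneg y).eq_or_lt with h0 | h0
    · rw [← h0]; positivity
    · exact le_of_mul_le_mul_right h4 h0
  refine ContinuousLinearMap.opNorm_le_bound _ (by positivity) fun x => ?_
  have hx := E.starProjection_add_starProjection_orthogonal x
  have hDx := E.starProjection_add_starProjection_orthogonal (D x)
  have hn := (Submodule.norm_sq_eq_add_norm_sq_starProjection x E).symm
  have e : D x = (E.starProjection (D (E.starProjection x)) +
      Eᗮ.starProjection (D (Eᗮ.starProjection x))) +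
      (E.starProjection (D (Eᗮ.starProjection x)) +
      Eᗮ.starProjection (D (E.starProjection x))) := by
    nth_rewrite 1 [← hDx]
    nth_rewrite 1 [← hx]
    nth_rewrite 3 [← hx]
    simp only [map_add]
    abel
  rw [e, add_mul]
  refine (norm_add_le _ _).trans (add_le_add ?_ ?_)
  · exact norm_add_le_of_mem_orthogonal (E.starProjection_apply_mem _)
      (Eᗮ.starProjection_apply_mem _) (norm_nonneg x) hc (h1 x) (h2 x) hn
  · exact norm_add_le_of_mem_orthogonal (E.starProjection_apply_mem _)
      (Eᗮ.starProjection_apply_mem _) (norm_nonneg x) (norm_nonneg (corner E D)) (h3 x)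
      (norm_starProjection_orthogonal_le_corner E D x) ((add_comm _ _).trans hn)

/-- Near `P₀`, a projection is determined in a Lipschitz way by its corner relative to the range
of `P₀`. -/
theorem norm_sub_le_norm_corner {E : Submodule ℂ H} {P P' : H →L[ℂ] H} (hP : IsStarProjection P)
    (hP' : IsStarProjection P') {δ : ℝ} (h : ‖P - E.starProjection‖ ≤ δ)
    (h' : ‖P' - E.starProjection‖ ≤ δ) :
    (1 - 2 * δ) * ‖P - P'‖ ≤ ‖corner E (P - P')‖ := by
  have hδ : 0 ≤ δ := (norm_nonneg _).trans h
  set p := E.starProjection with hp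
  set A := P - p with hA
  set B := P' - p with hB
  set D := P - P' with hD
  have hPP : P * P = P := hP.isIdempotentElem
  have hPP' : P' * P' = P' := hP'.isIdempotentElem
  have hpp : p * p = p := E.isIdempotentElem_starProjection
  -- Writing `P = p + A`, `P' = p + B` turns this into `A D + D B = D - p D - D p`. Compressing by
  -- `p` gives `-pDp`, by `1 - p` the other diagonal block, so both blocks are at most `2δ‖D‖`.
  have hDD : D = P * D + D * P' := by
    rw [hD, mul_sub, sub_mul, hPP, hPP']; abel
  have hq : Eᗮ.starProjection = 1 - p := E.starProjection_orthogonal'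
  have hnA : ‖A * D + D * B‖ ≤ 2 * δ * ‖D‖ := by
    refine (norm_add_le _ _).trans ?_
    have := norm_mul_le A D
    have := norm_mul_le D B
    nlinarith [norm_nonneg D]
  have e1 : p * D * p = -(p * (A * D + D * B) * p) := by
    have : A * D + D * B = D - p * D - D * p := by
      nth_rewrite 3 [hDD]; rw [hA, hB]; noncomm_ring
    rw [this]
    have : p * (D - p * D - D * p) * p = p * D * p - (p * p) * D * p - p * D * (p * p) := by
      noncomm_ring
    rw [this, hpp]; abel
  have e2 : (1 - p) * D * (1 - p) = (1 - p) * (A * D + D * B) * (1 - p) := by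
    have : A * D + D * B = D - p * D - D * p := by
      nth_rewrite 3 [hDD]; rw [hA, hB]; noncomm_ring
    rw [this]
    have : (1 - p) * (D - p * D - D * p) * (1 - p) =
        (1 - p) * D * (1 - p) - (p - p * p) * D * (1 - p) - (1 - p) * D * (p - p * p) := by
      noncomm_ring
    rw [this, hpp]; simp
  have := norm_le_add_norm_corner E (D := D) (hP.isSelfAdjoint.sub hP'.isSelfAdjoint)
    (c := 2 * δ * ‖D‖) (by positivity) (fun x => ?_) (fun x => ?_)
  · linarith
  · have hx := DFunLike.congr_fun e1 x
    have hpx : p (p x) = p x := DFunLike.congr_fun hpp x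
    change p (D (p x)) = -(p ((A * D + D * B) (p x))) at hx
    rw [← hp, hx, norm_neg]
    exact (E.norm_starProjection_apply_le _).trans (ContinuousLinearMap.le_of_opNorm_le _ hnA _)
  · have hx := DFunLike.congr_fun e2 x
    change (1 - p) (D ((1 - p) x)) = (1 - p) ((A * D + D * B) ((1 - p) x)) at hx
    rw [← hq] at hx
    rw [hx]
    exact (Eᗮ.norm_starProjection_apply_le _).trans (ContinuousLinearMap.le_of_opNorm_le _ hnA _)

theorem packingNumber_quarter_rankProjections_le (n : ℕ) :
    (packingNumber (1 / 4) (rankProjections H n) : ℝ≥0∞) ≤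
      ENNReal.ofReal (25 ^ finrank ℂ H ^ 2) := by
  refine packingNumber_le_ofReal fun s hs hsep => ?_
  have := card_le_of_separated_of_norm_sub_le s ((1 / 2 : ℂ) • (1 : H →L[ℂ] H))
    (R := 1 / 2) (t := 1 / 4) (by norm_num) (by norm_num)
    (fun c hc => norm_sub_half_le (hs hc).1)
    (fun c hc d hd hcd => by simpa using le_norm_sub_of_isSeparated hsep hc hd hcd)
  refine this.trans_eq ?_
  -- The base is `1 + 2(1/2)/(1/4) = 5`, and `5² = 25`.
  rw [finrank_continuousLinearMap_self, pow_mul]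
  norm_num

theorem card_le_of_isSeparated_of_norm_sub_le {n : ℕ} {ε : ℝ≥0} (hε : 0 < ε)
    {P₀ : H →L[ℂ] H} (hP₀ : P₀ ∈ rankProjections H n) (s : Finset (H →L[ℂ] H))
    (hs : (s : Set (H →L[ℂ] H)) ⊆ rankProjections H n)
    (hsep : IsSeparated ε (s : Set (H →L[ℂ] H))) (hnear : ∀ P ∈ s, ‖P - P₀‖ ≤ 1 / 4) :
    (s.card : ℝ) ≤ (1 + 1 / (ε : ℝ)) ^ (2 * n * (finrank ℂ H - n)) := by
  classical
  have hε' : (0 : ℝ) < ε := hε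
  obtain ⟨_, hP⟩ := isStarProjection_iff_eq_starProjection_range.1 hP₀.1
  set E := P₀.range with hE
  have hn : finrank ℂ E = n := hP₀.2
  rw [hP] at hnear
  have key (c) (hc : c ∈ s) (d) (hd : d ∈ s) :
      1 / 2 * ‖c - d‖ ≤ ‖corner E c - corner E d‖ := by
    have := norm_sub_le_norm_corner (hs hc).1 (hs hd).1 (hnear c hc) (hnear d hd)
    rw [map_sub] at this
    linarith
  have hinj : Set.InjOn (corner E) s := fun c hc d hd hcd => by
    have h1 := key c hc d hd
    have h2 : ‖corner E c - corner E d‖ = 0 := by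
      rw [hcd, sub_self]
      exact norm_zero (E := E →L[ℂ] Eᗮ)
    exact sub_eq_zero.1 (norm_le_zero_iff.1 (by linarith))
  -- With `δ = 1/4` distances shrink at most by half, so the corners are `ε/2`-separated in a ball
  -- of radius 1/4: `1 + 2(1/4)/(ε/2) = 1 + 1/ε`.
  have := card_le_of_separated_of_norm_sub_le (s.image (corner E)) (corner E E.starProjection)
    (R := 1 / 4) (t := ε / 2) (by norm_num) (by positivity) ?_ ?_
  · rw [Finset.card_image_of_injOn hinj, finrank_continuousLinearMap_orthogonal, hn,
      ← mul_assoc] at this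
    convert this using 3
    field_simp
    norm_num
  · simp only [Finset.forall_mem_image]
    intro c hc
    rw [← map_sub]
    exact (norm_corner_le E _).trans (hnear c hc)
  · simp only [Finset.forall_mem_image]
    intro c hc d hd hcd
    have h1 := key c hc d hd
    have h2 := le_norm_sub_of_isSeparated hsep hc hd (fun h => hcd (by rw [h]))
    linarith

theorem coveringNumber_rankProjections_le (n : ℕ) {ε : ℝ≥0} (hε : 0 < ε) :
    (coveringNumber ε (rankProjections H n) : ℝ≥0∞) ≤ ENNReal.ofReal
      (25 ^ finrank ℂ H ^ 2 * (1 + 1 / (ε : ℝ)) ^ (2 * n * (finrank ℂ H - n))) := by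
  classical
  refine le_trans (by exact_mod_cast coveringNumber_le_packingNumber ε _)
    (packingNumber_le_ofReal fun s hs hsep => ?_)
  have hcov : (coveringNumber (1 / 4) (rankProjections H n) : ℝ≥0∞) ≤
      ENNReal.ofReal (25 ^ finrank ℂ H ^ 2) :=
    le_trans (by exact_mod_cast coveringNumber_le_packingNumber _ _)
      (packingNumber_quarter_rankProjections_le n)
  have htop : coveringNumber (1 / 4) (rankProjections H n) ≠ ⊤ := fun h => by
    rw [h] at hcov
    exact (ENNReal.ofReal_lt_top.trans_le' hcov).ne rfl
  -- The centres are themselves projections of rank `n`, as the local bound requires.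
  obtain ⟨C, hCs, hCfin, hC, hCcard⟩ := exists_set_encard_eq_coveringNumber htop
  lift C to Finset (H →L[ℂ] H) using hCfin
  rw [← hCcard, Set.encard_coe_eq_coe_finsetCard] at hcov
  have hCK : (C.card : ℝ) ≤ 25 ^ finrank ℂ H ^ 2 := by
    have := ENNReal.toReal_le_of_le_ofReal (by positivity) hcov
    simpa using this
  have hsub : s ⊆ C.biUnion fun c => s.filter fun P => ‖P - c‖ ≤ 1 / 4 := fun P hP => by
    obtain ⟨c, hc, hPc⟩ := exists_norm_sub_le_of_isCover hC (hs hP)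
    simp only [Finset.mem_biUnion, Finset.mem_filter]
    exact ⟨c, hc, hP, by simpa using hPc⟩
  calc (s.card : ℝ) ≤ ∑ c ∈ C, ((s.filter fun P => ‖P - c‖ ≤ 1 / 4).card : ℝ) := by
        exact_mod_cast (Finset.card_le_card hsub).trans Finset.card_biUnion_le
    _ ≤ ∑ c ∈ C, (1 + 1 / (ε : ℝ)) ^ (2 * n * (finrank ℂ H - n)) := by
        refine Finset.sum_le_sum fun c hc => ?_
        have hss : ((s.filter fun P => ‖P - c‖ ≤ 1 / 4 : Finset _) : Set (H →L[ℂ] H)) ⊆ s := by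
          exact_mod_cast Finset.filter_subset _ s
        exact card_le_of_isSeparated_of_norm_sub_le hε (hCs hc) _ (hss.trans hs) (hsep.mono hss)
          fun P hP => (Finset.mem_filter.1 hP).2
    _ ≤ _ := by
        rw [Finset.sum_const, nsmul_eq_mul]
        exact mul_le_mul_of_nonneg_right hCK (by positivity)

/-! ### Graphs and the lower bound -/

theorem graphProjection_mem {E : Submodule ℂ H} (X : E →L[ℂ] Eᗮ) :
    graphProjection X ∈ rankProjections H (finrank ℂ E) := by
  refine ⟨isStarProjection_starProjection, ?_⟩
  have : LinearMap.range (graphProjection X : H →ₗ[ℂ] H) = LinearMap.range (graphMap X) :=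
    Submodule.range_starProjection _
  rw [this]
  refine LinearMap.finrank_range_of_inj fun v w hvw => ?_
  rw [← sub_eq_zero, ← map_sub, graphMap_apply] at hvw
  have h := (norm_le_norm_add_of_mem_orthogonal (v - w).2 (X (v - w)).2).1
  rw [hvw, norm_zero] at h
  exact sub_eq_zero.1 (Subtype.ext (norm_le_zero_iff.1 h))

theorem le_coveringNumber_rankProjections {n : ℕ} (hn : n ≤ finrank ℂ H) {ε : ℝ≥0}
    (hε : 0 < ε) :
    ENNReal.ofReal ((1 / (8 * (ε : ℝ))) ^ (2 * n * (finrank ℂ H - n))) ≤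
      (coveringNumber ε (rankProjections H n) : ℝ≥0∞) := by
  classical
  have hε' : (0 : ℝ) < ε := hε
  by_cases htop : coveringNumber ε (rankProjections H n) = ⊤
  · simp [htop]
  obtain ⟨C, hCs, hCfin, hC, hCcard⟩ := exists_set_encard_eq_coveringNumber htop
  lift C to Finset (H →L[ℂ] H) using hCfin
  rw [← hCcard, Set.encard_coe_eq_coe_finsetCard]
  obtain ⟨E, hE⟩ : ∃ E : Submodule ℂ H, finrank ℂ E = n :=
    ⟨Submodule.span ℂ (Set.range (finBasis ℂ H ∘ Fin.castLE hn)), by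
      rw [finrank_span_eq_card ((finBasis ℂ H).linearIndependent.comp _
        (Fin.castLE_injective hn)), Fintype.card_fin]⟩
  let near (c : H →L[ℂ] H) (X : E →L[ℂ] Eᗮ) : Prop := ‖X‖ ≤ 1 ∧ ‖graphProjection X - c‖ ≤ ε
  -- One contraction is chosen per centre. Two contractions near the same centre have graph
  -- projections within `2ε`, so they differ by at most `8ε`; the default 0 is harmless.
  let f (c : H →L[ℂ] H) : E →L[ℂ] Eᗮ := if h : ∃ X, near c X then h.choose else 0
  have hf (c) (X) (h : near c X) : near c (f c) := by
    have h' : ∃ X, near c X := ⟨X, h⟩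
    simp only [f, dif_pos h']
    exact h'.choose_spec
  have hcov := one_le_card_mul_pow_of_cover (C.image f) (r := 8 * ε) (by positivity) fun X hX => by
    have hmem := graphProjection_mem X
    rw [hE] at hmem
    obtain ⟨c, hc, hXc⟩ := exists_norm_sub_le_of_isCover hC hmem
    refine ⟨f c, Finset.mem_image_of_mem f hc, ?_⟩
    obtain ⟨h1, h2⟩ := hf c X ⟨hX, hXc⟩
    refine (norm_sub_le_graphProjection hX h1).trans ?_
    have := norm_sub_le_norm_sub_add_norm_sub (graphProjection X) c (graphProjection (f c))
    rw [norm_sub_rev c] at this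
    linarith
  rw [finrank_continuousLinearMap_orthogonal, hE, ← mul_assoc] at hcov
  have hcard : (((C.image f).card : ℕ) : ℝ) ≤ C.card := by exact_mod_cast Finset.card_image_le
  have : (1 / (8 * (ε : ℝ))) ^ (2 * n * (finrank ℂ H - n)) ≤ C.card := by
    rw [one_div, inv_pow, inv_le_iff_one_le_mul₀ (by positivity)]
    exact hcov.trans (mul_le_mul_of_nonneg_right hcard (by positivity))
  calc _ ≤ ENNReal.ofReal (C.card : ℝ) := ENNReal.ofReal_le_ofReal this
    _ = _ := by simp

end Grassmannian

/-! ### The explicit constants -/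

theorem two_mul_mul_sub_le_sq (m n : ℕ) : 2 * n * (m - n) ≤ m ^ 2 := by
  rcases le_total n m with h | h
  · obtain ⟨k, rfl⟩ := Nat.exists_eq_add_of_le h
    rw [Nat.add_sub_cancel_left]
    nlinarith [sq_nonneg n, sq_nonneg k]
  · simp [Nat.sub_eq_zero_of_le h]

theorem mainTheorem1 :
    (∀ (m n : ℕ) (H : Type*) [NormedAddCommGroup H] [InnerProductSpace ℂ H] [CompleteSpace H]
        [FiniteDimensional ℂ H],
        Module.finrank ℂ H = m → n ≤ m → ∀ ε : ℝ≥0, 0 < ε →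
          (ε ≤ 1 / 71 →
            ENNReal.ofReal (1 / 19 ^ (m ^ 2) * (9 / (5 * (ε : ℝ))) ^ (2 * n * (m - n)))
              ≤ (Metric.coveringNumber ε (rankProjections H n) : ℝ≥0∞)) ∧
          (ε ≤ 1 / 10 →
            (Metric.coveringNumber ε (rankProjections H n) : ℝ≥0∞)
              ≤ ENNReal.ofReal (38 ^ (m ^ 2) * (3 / (4 * (ε : ℝ))) ^ (2 * n * (m - n))))) ∧
    (∀ α : ℝ, 0 < α → ∃ ε₀ : ℝ≥0, 0 < ε₀ ∧ ∃ c : ℝ, 0 < c ∧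
      ∀ (m n : ℕ) (H : Type*) [NormedAddCommGroup H] [InnerProductSpace ℂ H] [CompleteSpace H]
        [FiniteDimensional ℂ H],
        Module.finrank ℂ H = m → α * m ≤ n → α * m ≤ (m : ℝ) - n →
          ∀ ε : ℝ≥0, 0 < ε → ε ≤ ε₀ →
            ENNReal.ofReal (Real.exp (c * (m : ℝ) ^ 2))
              ≤ (Metric.coveringNumber ε (rankProjections H n) : ℝ≥0∞)) := by
  refine ⟨fun m n H _ _ _ _ hm hn ε hε => ⟨fun _ => ?_, fun hε1 => ?_⟩, fun α hα => ?_⟩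
  · subst hm
    have hε' : (0 : ℝ) < ε := hε
    refine (ENNReal.ofReal_le_ofReal ?_).trans (le_coveringNumber_rankProjections hn hε)
    set d := 2 * n * (finrank ℂ H - n)
    have hd : d ≤ finrank ℂ H ^ 2 := two_mul_mul_sub_le_sq _ _
    -- The excess factor `72/5 < 19` per exponent is absorbed by `19^(m²)`.
    have e : 9 / (5 * (ε : ℝ)) = 72 / 5 * (1 / (8 * ε)) := by field_simp; norm_num
    rw [e, mul_pow, ← mul_assoc]
    refine mul_le_of_le_one_left (by positivity) ?_
    rw [one_div_mul_eq_div, div_le_one (by positivity)]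
    calc (72 / 5 : ℝ) ^ d ≤ 19 ^ d := by gcongr; norm_num
      _ ≤ 19 ^ finrank ℂ H ^ 2 := pow_le_pow_right₀ (by norm_num) hd
  · subst hm
    have hε' : (0 : ℝ) < ε := hε
    have hε1' : (ε : ℝ) ≤ 1 / 10 := by exact_mod_cast hε1
    refine (coveringNumber_rankProjections_le n hε).trans (ENNReal.ofReal_le_ofReal ?_)
    set d := 2 * n * (finrank ℂ H - n)
    have hd : d ≤ finrank ℂ H ^ 2 := two_mul_mul_sub_le_sq _ _
    -- Since `(38/25)(3/4) = 1.14`, this needs only `ε ≤ 7/50`; the excess `38/25` per exponent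
    -- turns `25^(m²)` into `38^(m²)`.
    have e : 1 + 1 / (ε : ℝ) ≤ 38 / 25 * (3 / (4 * ε)) := by
      have : 38 / 25 * (3 / (4 * (ε : ℝ))) - (1 + 1 / ε) = (7 / 50 - ε) / ε := by
        field_simp; ring
      have : 0 ≤ (7 / 50 - (ε : ℝ)) / ε := div_nonneg (by linarith) hε'.le
      linarith
    calc (25 : ℝ) ^ finrank ℂ H ^ 2 * (1 + 1 / (ε : ℝ)) ^ d
        ≤ 25 ^ finrank ℂ H ^ 2 * ((38 / 25) ^ finrank ℂ H ^ 2 * (3 / (4 * ε)) ^ d) := by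
          gcongr
          refine (pow_le_pow_left₀ (by positivity) e d).trans ?_
          rw [mul_pow]
          gcongr
          norm_num
      _ = 38 ^ finrank ℂ H ^ 2 * (3 / (4 * ε)) ^ d := by
          rw [← mul_assoc, ← mul_pow]; norm_num
  -- This `ε₀` makes the base `1/(8ε)` at least `e`, while the exponent satisfies `2n(m-n) ≥ 2α²m²`.
  · refine ⟨Real.toNNReal (1 / (8 * Real.exp 1)), Real.toNNReal_pos.2 (by positivity),
      2 * α ^ 2, by positivity, ?_⟩
    intro m n H _ _ _ _ hm h1 h2 ε hε hε0
    subst hm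
    have hε' : (0 : ℝ) < ε := hε
    have hε0' : (ε : ℝ) ≤ 1 / (8 * Real.exp 1) := by
      rw [← Real.coe_toNNReal (1 / (8 * Real.exp 1)) (by positivity)]
      exact_mod_cast hε0
    have hn : n ≤ finrank ℂ H := by
      have : 0 ≤ α * (finrank ℂ H : ℝ) := by positivity
      exact_mod_cast (by linarith : (n : ℝ) ≤ finrank ℂ H)
    refine (ENNReal.ofReal_le_ofReal ?_).trans (le_coveringNumber_rankProjections hn hε)
    have he : Real.exp 1 ≤ 1 / (8 * ε) := by
      rw [le_div_iff₀ (by positivity)] at hε0' ⊢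
      linarith
    calc Real.exp (2 * α ^ 2 * (finrank ℂ H : ℝ) ^ 2)
        ≤ Real.exp ((2 * n * (finrank ℂ H - n) : ℕ) * 1) := by
          apply Real.exp_le_exp.2
          push_cast [Nat.cast_sub hn]
          have := mul_le_mul h1 h2 (by positivity) (by positivity)
          linarith
      _ = Real.exp 1 ^ (2 * n * (finrank ℂ H - n)) := Real.exp_nat_mul _ _
      _ ≤ _ := pow_le_pow_left₀ (Real.exp_pos 1).le he _
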